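/- Fix $q\in(0,1)$ such that $\frac{\log(1-q)}{\log q}\in\mathbb{Z}$, and let $\mathbb{R}_{q,+}=\{q^n : n\in\mathbb{Z}\}$. For a function $g$ on $\mathbb{R}_{q,+}$ put $$\int_0^\infty g(t)\,d_qt=(1-q)\sum_{n\in\mathbb{Z}} g(q^n)q^n ,$$ where the sum is required to converge absolutely, or is taken in $[0,\infty]$ if $g\ge 0$. Let $L^2_q(\mathbb{R}_{q,+})$ be the set of functions $f:\mathbb{R}_{q,+}\to\mathbb{C}$ with $\|f\|_{q,2}=\left(\int_0^\infty |f(t)|^2\,d_qt\right)^{1/2}<\infty$, and let $D_qf(x)=\frac{f(x)-f(qx)}{(1-q)x}$. With $(a;q)_n=\prod_{k=0}^{n-1}(1-aq^k)$ for $n\in\mathbb{N}\cup\{\infty\}$, let $$[n]_q!=\frac{(q;q)_n}{(1-q)^n},\qquad \Gamma_q(x)=\frac{(q;q)_\infty}{(q^x;q)_\infty}(1-q)^{1-x},\qquad \sin(x;q^2)=\sum_{n=0}^\infty(-1)^nq^{n(n-1)}\frac{x^{2n+1}}{[2n+1]_q!},$$ and define the $q$-Fourier-sine transform by $${}_q\mathcal{F}(f)(\lambda)=c_q\int_0^\infty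 f(t)\sin(\lambda t;q^2)\,d_qt,\qquad c_q=\frac{(1+q^{-1})^{1/2}}{\Gamma_{q^2}(1/2)} .$$ **Theorem.** Let $f\in L^2_q(\mathbb{R}_{q,+})$ be such that $D_qf\in L^2_q(\mathbb{R}_{q,+})$ and $f(0)=0$, where $f(0)$ denotes the limit of $f(t)$ as $t\to0$ in $\mathbb{R}_{q,+}$. Then the integral defining ${}_q\mathcal{F}(f)(\lambda)$ converges absolutely for every $\lambda\in\mathbb{R}_{q,+}$, and, in $[0,\infty]$, $$\left(\int_0^\infty t^2|f(t)|^2\,d_qt\right)^{1/2}\left(\int_0^\infty \lambda^2\,|{}_q\mathcal{F}(f)(\lambda)|^2\,d_q\lambda\right)^{1/2}\ \ge\ \frac{q}{q^{-3/2}+1}\,\|f\|_{q,2}^2 .$$ -/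

import Mathlib

open Filter Topology
open scoped ENNReal

noncomputable section

/-- The set `ℝ_{q,+} = {q ^ n : n ∈ ℤ}`. -/
def qLattice (q : ℝ) : Set ℝ := Set.range fun n : ℤ => q ^ n

/-- The infinite shifted factorial `(a; q)_∞ = ∏_{k ≥ 0} (1 - a q ^ k)`. -/
def qPochInf (a q : ℝ) : ℝ := ∏' k : ℕ, (1 - a * q ^ k)

/-- The finite shifted factorial `(a; q)_n = ∏_{k < n} (1 - a q ^ k)`. -/
def qPoch (a q : ℝ) (n : ℕ) : ℝ := ∏ k ∈ Finset.range n, (1 - a * q ^ k)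

/-- `[n]_q! = (q; q)_n / (1 - q) ^ n`. -/
def qFactorial (q : ℝ) (n : ℕ) : ℝ := qPoch q q n / (1 - q) ^ n

/-- Jackson's `q`-Gamma function `Γ_q(x) = (q; q)_∞ / (q ^ x; q)_∞ * (1 - q) ^ (1 - x)`. -/
def qGamma (q x : ℝ) : ℝ := qPochInf q q / qPochInf (q ^ x) q * (1 - q) ^ (1 - x)

/-- `sin(x; q²) = ∑_{n ≥ 0} (-1) ^ n q ^ (n (n - 1)) x ^ (2 n + 1) / [2 n + 1]_q!`. -/
def qSin (q x : ℝ) : ℝ :=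
  ∑' n : ℕ, (-1) ^ n * q ^ (n * (n - 1)) * x ^ (2 * n + 1) / qFactorial q (2 * n + 1)

/-- The `q`-derivative `D_q f`. -/
def qDeriv (q : ℝ) (f : ℝ → ℂ) (x : ℝ) : ℂ :=
  if x = 0 then deriv f 0 else (f x - f (q * x)) / (((1 - q) * x : ℝ) : ℂ)

/-- Absolute convergence of the Jackson integral of `g` over `(0, ∞)`. -/
def QIntegrable (q : ℝ) (g : ℝ → ℂ) : Prop :=
  Summable fun n : ℤ => ‖g (q ^ n) * ((q ^ n : ℝ) : ℂ)‖

/-- The Jackson integral `∫_0^∞ g(x) d_q x = (1 - q) ∑_{n ∈ ℤ} g(q ^ n) q ^ n`. -/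
def qIntegral (q : ℝ) (g : ℝ → ℂ) : ℂ :=
  ((1 - q : ℝ) : ℂ) * ∑' n : ℤ, g (q ^ n) * ((q ^ n : ℝ) : ℂ)

/-- The Jackson integral over `(0, ∞)` of a nonnegative function, with values in `[0, ∞]`. -/
def qLIntegral (q : ℝ) (g : ℝ → ℝ≥0∞) : ℝ≥0∞ :=
  ENNReal.ofReal (1 - q) * ∑' n : ℤ, g (q ^ n) * ENNReal.ofReal (q ^ n)

/-- `f ∈ L²_q(ℝ_{q,+})`; only the values of `f` on `ℝ_{q,+}` matter. -/
def MemL2q (q : ℝ) (f : ℝ → ℂ) : Prop :=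
  qLIntegral q (fun t => ENNReal.ofReal (‖f t‖ ^ 2)) < ⊤

/-- The norm `‖f‖_{q,2}`, with values in `[0, ∞]`. -/
def l2qNorm (q : ℝ) (f : ℝ → ℂ) : ℝ≥0∞ :=
  qLIntegral q (fun t => ENNReal.ofReal (‖f t‖ ^ 2)) ^ (1 / 2 : ℝ)

/-- The constant `c_q = (1 + q⁻¹) ^ (1 / 2) / Γ_{q²}(1 / 2)`. -/
def qFourierConst (q : ℝ) : ℝ := (1 + q⁻¹) ^ (1 / 2 : ℝ) / qGamma (q ^ 2) (1 / 2)

/-- The `q`-Fourier-sine transform `c_q ∫_0^∞ f(t) sin(x t; q²) d_q t`. -/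
def qFourierSine (q : ℝ) (f : ℝ → ℂ) (x : ℝ) : ℂ :=
  (qFourierConst q : ℂ) * qIntegral q fun t => f t * (qSin q (x * t) : ℂ)

end

/-! ### Infinite shifted factorials -/

lemma summable_norm_mul_pow {p : ℝ} (hp0 : 0 < p) (hp1 : p < 1) (z : ℝ) :
    Summable fun k : ℕ => ‖-(z * p ^ k)‖ := by
  simpa using (summable_geometric_of_lt_one hp0.le hp1).norm.mul_left |z|

lemma multipliable_one_sub_mul_pow {p : ℝ} (hp0 : 0 < p) (hp1 : p < 1) (z : ℝ) :
    Multipliable fun k : ℕ => 1 - z * p ^ k := by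
  simpa [sub_eq_add_neg] using multipliable_one_add_of_summable (summable_norm_mul_pow hp0 hp1 z)

lemma qPochInf_eq_one_sub_mul {p : ℝ} (hp0 : 0 < p) (hp1 : p < 1) (z : ℝ) :
    qPochInf z p = (1 - z) * qPochInf (z * p) p := by
  have h1 : ∀ k : ℕ, 1 - z * p * p ^ k = 1 - z * p ^ (k + 1) := fun k => by ring
  have h : Multipliable fun k : ℕ => 1 - z * p ^ (k + 1) := by
    simpa only [h1] using multipliable_one_sub_mul_pow hp0 hp1 (z * p)
  have h2 := tprod_eq_zero_mul' (f := fun k : ℕ => 1 - z * p ^ k) h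
  simp only [qPochInf, h1]
  rw [h2, pow_zero, mul_one]

lemma qPochInf_eq_qPoch_mul {p : ℝ} (hp0 : 0 < p) (hp1 : p < 1) (z : ℝ) (n : ℕ) :
    qPochInf z p = qPoch z p n * qPochInf (z * p ^ n) p := by
  induction n with
  | zero => simp [qPoch]
  | succ n ih =>
    rw [ih, qPochInf_eq_one_sub_mul hp0 hp1 (z * p ^ n), qPoch, qPoch, Finset.prod_range_succ,
      mul_assoc, pow_succ]
    ring_nf

lemma one_sub_mul_pow_pos {p z : ℝ} (hp0 : 0 < p) (hp1 : p < 1) (hz : z < 1) (k : ℕ) :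
    0 < 1 - z * p ^ k := by
  have h1 : p ^ k ≤ 1 := pow_le_one₀ hp0.le hp1.le
  have h2 : 0 < p ^ k := pow_pos hp0 k
  nlinarith

lemma qPochInf_nonneg {p z : ℝ} (hp0 : 0 < p) (hp1 : p < 1) (hz : z ≤ 1) :
    0 ≤ qPochInf z p := by
  refine tprod_nonneg fun k => ?_
  have h1 : p ^ k ≤ 1 := pow_le_one₀ hp0.le hp1.le
  have h2 : 0 < p ^ k := pow_pos hp0 k
  nlinarith

lemma qPochInf_pos {p z : ℝ} (hp0 : 0 < p) (hp1 : p < 1) (hz : z < 1) : 0 < qPochInf z p := by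
  refine (qPochInf_nonneg hp0 hp1 hz.le).lt_of_ne' ?_
  have := tprod_one_add_ne_zero_of_summable (f := fun k : ℕ => -(z * p ^ k))
    (fun k => by simpa [sub_eq_add_neg] using (one_sub_mul_pow_pos hp0 hp1 hz k).ne')
    (summable_norm_mul_pow hp0 hp1 z)
  simpa [qPochInf, sub_eq_add_neg] using this

lemma qPochInf_le_one {p z : ℝ} (hp0 : 0 < p) (hz0 : 0 ≤ z) (hz : z ≤ 1) (hp1 : p < 1) :
    qPochInf z p ≤ 1 := by
  refine le_of_tendsto' (multipliable_one_sub_mul_pow hp0 hp1 z).hasProd.tendsto_prod_nat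
    fun n => Finset.prod_le_one (fun k _ => ?_) fun k _ => ?_
  · have h1 : p ^ k ≤ 1 := pow_le_one₀ hp0.le hp1.le
    have h2 : 0 < p ^ k := pow_pos hp0 k
    nlinarith
  · have : 0 ≤ z * p ^ k := by positivity
    linarith

lemma qPoch_pos {p z : ℝ} (hp0 : 0 < p) (hp1 : p < 1) (hz : z < 1) (n : ℕ) : 0 < qPoch z p n :=
  Finset.prod_pos fun k _ => one_sub_mul_pow_pos hp0 hp1 hz k

lemma qPochInf_le_qPoch {p z : ℝ} (hp0 : 0 < p) (hp1 : p < 1) (hz0 : 0 ≤ z) (hz : z < 1) (n : ℕ) :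
    qPochInf z p ≤ qPoch z p n := by
  rw [qPochInf_eq_qPoch_mul hp0 hp1 z n]
  have hn : p ^ n ≤ 1 := pow_le_one₀ hp0.le hp1.le
  have hn0 : 0 < p ^ n := pow_pos hp0 n
  exact mul_le_of_le_one_right (qPoch_pos hp0 hp1 hz n).le
    (qPochInf_le_one hp0 (by positivity) (by nlinarith) hp1)

lemma qPoch_succ (z p : ℝ) (n : ℕ) : qPoch z p (n + 1) = qPoch z p n * (1 - z * p ^ n) :=
  Finset.prod_range_succ _ _

/-- `(q; q)_{2n} = (q²; q²)_n (q; q²)_n`. -/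
lemma qPoch_two_mul (q : ℝ) (n : ℕ) :
    qPoch q q (2 * n) = qPoch (q ^ 2) (q ^ 2) n * qPoch q (q ^ 2) n := by
  induction n with
  | zero => simp [qPoch]
  | succ n ih =>
    rw [show 2 * (n + 1) = 2 * n + 1 + 1 by ring, qPoch_succ, qPoch_succ, ih, qPoch_succ,
      qPoch_succ]
    ring

/-! ### Euler's expansion of the infinite shifted factorial -/

lemma summable_pow_mul_pred_mul_pow {q : ℝ} (hq0 : 0 < q) (hq1 : q < 1) (x : ℝ) :
    Summable fun j : ℕ => q ^ (j * (j - 1)) * |x| ^ j := by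
  have key : Summable fun j : ℕ => q ^ (j * (j - 1)) * (|x| + 1) ^ j := by
    have hx : 0 < |x| + 1 := by positivity
    refine summable_of_ratio_test_tendsto_lt_one (l := 0) one_pos
      (Eventually.of_forall fun n => by positivity) ?_
    have h : Tendsto (fun n : ℕ => (q ^ 2) ^ n * (|x| + 1)) atTop (𝓝 (0 * (|x| + 1))) :=
      (tendsto_pow_atTop_nhds_zero_of_lt_one (by positivity) (by nlinarith)).mul_const _
    rw [zero_mul] at h
    refine h.congr fun n => ?_
    rw [Real.norm_of_nonneg (by positivity), Real.norm_of_nonneg (by positivity),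
      eq_div_iff (by positivity)]
    rcases n with _ | n
    · simp
    · simp only [Nat.add_sub_cancel]
      ring
  refine key.of_nonneg_of_le (fun j => by positivity) fun j => ?_
  gcongr
  linarith [abs_nonneg x]

/-- The general term of Euler's expansion of `(z; q²)_∞`. -/
noncomputable def eulerTerm (q z : ℝ) (j : ℕ) : ℝ :=
  (-1) ^ j * q ^ (j * (j - 1)) * z ^ j / qPoch (q ^ 2) (q ^ 2) j

lemma sq_lt_one_of_pos {q : ℝ} (hq0 : 0 < q) (hq1 : q < 1) : q ^ 2 < 1 := by nlinarith

lemma abs_eulerTerm_le {q : ℝ} (hq0 : 0 < q) (hq1 : q < 1) (z : ℝ) (j : ℕ) :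
    |eulerTerm q z j| ≤ (qPochInf (q ^ 2) (q ^ 2))⁻¹ * (q ^ (j * (j - 1)) * |z| ^ j) := by
  have hp0 : 0 < q ^ 2 := by positivity
  have hp1 := sq_lt_one_of_pos hq0 hq1
  have h0 := qPochInf_pos hp0 hp1 hp1
  have h1 := qPochInf_le_qPoch hp0 hp1 hp0.le hp1 j
  rw [eulerTerm, abs_div, abs_mul, abs_mul, abs_pow, abs_neg, abs_one, one_pow, one_mul,
    abs_of_pos (qPoch_pos hp0 hp1 hp1 j), abs_pow, abs_pow, abs_of_pos hq0, div_eq_inv_mul]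
  gcongr

lemma summable_eulerTerm {q : ℝ} (hq0 : 0 < q) (hq1 : q < 1) (z : ℝ) :
    Summable (eulerTerm q z) :=
  .of_norm_bounded ((summable_pow_mul_pred_mul_pow hq0 hq1 z).mul_left _)
    (abs_eulerTerm_le hq0 hq1 z)

lemma tsum_eulerTerm_eq {q : ℝ} (hq0 : 0 < q) (hq1 : q < 1) (z : ℝ) :
    ∑' j, eulerTerm q z j = (1 - z) * ∑' j, eulerTerm q (z * q ^ 2) j := by
  have hp0 : 0 < q ^ 2 := by positivity
  have hp1 := sq_lt_one_of_pos hq0 hq1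
  have hz := summable_eulerTerm hq0 hq1 z
  have hzp := summable_eulerTerm hq0 hq1 (z * q ^ 2)
  have key : ∀ j, eulerTerm q z (j + 1) - eulerTerm q (z * q ^ 2) (j + 1)
      = -z * eulerTerm q (z * q ^ 2) j := by
    intro j
    have h1 := (qPoch_pos hp0 hp1 hp1 j).ne'
    have h2 := (one_sub_mul_pow_pos hp0 hp1 hp1 j).ne'
    simp only [eulerTerm, qPoch_succ]
    rw [← sub_div, mul_div_assoc', div_eq_div_iff (mul_ne_zero h1 h2) h1]
    rcases j with _ | j
    · simp
      ring
    · simp only [Nat.add_sub_cancel]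
      ring
  have h : ∑' j, eulerTerm q z j - ∑' j, eulerTerm q (z * q ^ 2) j
      = -z * ∑' j, eulerTerm q (z * q ^ 2) j := by
    rw [← hz.tsum_sub hzp, (hz.sub hzp).tsum_eq_zero_add, ← tsum_mul_left]
    simp_rw [key]
    simp [eulerTerm]
  linarith

lemma tendsto_tsum_eulerTerm {q : ℝ} (hq0 : 0 < q) (hq1 : q < 1) (z : ℝ) :
    Tendsto (fun n : ℕ => ∑' j, eulerTerm q (z * (q ^ 2) ^ n) j) atTop (𝓝 1) := by
  have hp0 : 0 < q ^ 2 := by positivity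
  have hp1 := sq_lt_one_of_pos hq0 hq1
  have h1 : ∑' j, eulerTerm q 0 j = 1 := by
    rw [tsum_eq_single 0 (fun j hj => by simp [eulerTerm, hj])]
    simp [eulerTerm, qPoch]
  rw [← h1]
  refine tendsto_tsum_of_dominated_convergence
    ((summable_pow_mul_pred_mul_pow hq0 hq1 z).mul_left (qPochInf (q ^ 2) (q ^ 2))⁻¹)
    (fun j => ?_) (Eventually.of_forall fun n j => ?_)
  · have h : Tendsto (fun n : ℕ => z * (q ^ 2) ^ n) atTop (𝓝 (z * 0)) :=
      (tendsto_pow_atTop_nhds_zero_of_lt_one hp0.le hp1).const_mul z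
    rw [mul_zero] at h
    have hc : Continuous fun y => eulerTerm q y j := by unfold eulerTerm; fun_prop
    exact (hc.tendsto 0).comp h
  · refine (abs_eulerTerm_le hq0 hq1 _ j).trans ?_
    have h0 := qPochInf_pos hp0 hp1 hp1
    have : |z * (q ^ 2) ^ n| ≤ |z| := by
      rw [abs_mul, abs_of_pos (pow_pos hp0 n)]
      exact mul_le_of_le_one_right (abs_nonneg z) (pow_le_one₀ hp0.le hp1.le)
    gcongr

/-- Euler's identity `(z; q²)_∞ = ∑ (-1)^j q^{j(j-1)} z^j / (q²; q²)_j`. -/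
theorem hasSum_eulerTerm {q : ℝ} (hq0 : 0 < q) (hq1 : q < 1) (z : ℝ) :
    HasSum (eulerTerm q z) (qPochInf z (q ^ 2)) := by
  have hp0 : 0 < q ^ 2 := by positivity
  have hp1 := sq_lt_one_of_pos hq0 hq1
  have hn : ∀ n, ∑' j, eulerTerm q z j
      = qPoch z (q ^ 2) n * ∑' j, eulerTerm q (z * (q ^ 2) ^ n) j := by
    intro n
    induction n with
    | zero => simp [qPoch]
    | succ n ih =>
      rw [ih, tsum_eulerTerm_eq hq0 hq1 (z * (q ^ 2) ^ n), qPoch_succ, mul_assoc (qPoch _ _ _),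
        mul_assoc z, ← pow_succ]
  have h1 : Tendsto (fun n => qPoch z (q ^ 2) n * ∑' j, eulerTerm q (z * (q ^ 2) ^ n) j) atTop
      (𝓝 (qPochInf z (q ^ 2) * 1)) :=
    (multipliable_one_sub_mul_pow hp0 hp1 z).hasProd.tendsto_prod_nat.mul
      (tendsto_tsum_eulerTerm hq0 hq1 z)
  have h2 : ∑' j, eulerTerm q z j = qPochInf z (q ^ 2) := by
    rw [← mul_one (qPochInf z (q ^ 2))]
    exact tendsto_nhds_unique (tendsto_const_nhds.congr hn) h1
  exact h2 ▸ (summable_eulerTerm hq0 hq1 z).hasSum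

/-! ### Convolution inverses and orthonormal translates -/

lemma abs_le_tsum_abs {ι : Type*} {a : ι → ℝ} (ha : Summable fun i => |a i|) (i : ι) :
    |a i| ≤ ∑' i, |a i| :=
  ha.le_tsum i fun _ _ => abs_nonneg _

/-- The bijection `(n, i) ↦ (n + c i, i)`. -/
def shearEquiv {ι : Type*} (c : ι → ℤ) : ℤ × ι ≃ ℤ × ι where
  toFun x := (x.1 + c x.2, x.2)
  invFun x := (x.1 - c x.2, x.2)
  left_inv x := by simp
  right_inv x := by simp

lemma hasSum_mul_fiberwise {f g : ℤ → ℤ → ℝ} {s t : ℤ → ℝ} {F : ℤ × (ℤ × ℤ) → ℝ}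
    (hf : ∀ k, HasSum (f k) (s k)) (hg : ∀ k, HasSum (g k) (t k)) (hF : Summable F)
    (hfg : ∀ k i j, F (k, i, j) = f k i * g k j) :
    HasSum (fun k => s k * t k) (∑' x, F x) := by
  refine HasSum.prod_fiberwise (f := F) hF.hasSum fun k => ?_
  have h : (fun x : ℤ × ℤ => F (k, x)) = fun x => f k x.1 * g k x.2 := by
    funext x
    exact hfg k x.1 x.2
  have h1 : Summable fun x : ℤ × ℤ => F (k, x) := hF.prod_factor k
  rw [h] at h1 ⊢
  exact (hf k).mul (hg k) h1

lemma summable_correlation_triple {a b : ℤ → ℝ} (ha : Summable fun i => |a i|)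
    (hb : Summable fun i => |b i|) (l m : ℤ) :
    Summable fun x : ℤ × (ℤ × ℤ) =>
      (a x.2.1 * b (x.1 + l + x.2.1)) * (a x.2.2 * b (x.1 + m + x.2.2)) := by
  have h0 : Summable fun x : ℤ × ℤ => |a x.1| * |a x.2| :=
    ha.mul_of_nonneg ha (fun _ => abs_nonneg _) fun _ => abs_nonneg _
  have h1 : Summable fun x : ℤ × (ℤ × ℤ) => |b x.1| * (|a x.2.1| * |a x.2.2|) :=
    Summable.mul_of_nonneg (g := fun x : ℤ × ℤ => |a x.1| * |a x.2|) hb h0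
      (fun _ => abs_nonneg _) fun _ => mul_nonneg (abs_nonneg _) (abs_nonneg _)
  have h2 := ((shearEquiv fun x : ℤ × ℤ => l + x.1).summable_iff.mpr h1).mul_right (∑' i, |b i|)
  refine Summable.of_norm_bounded h2 fun x => ?_
  simp only [norm_mul, Real.norm_eq_abs, Function.comp_apply, shearEquiv, Equiv.coe_fn_mk,
    ← add_assoc]
  calc |a x.2.1| * |b (x.1 + l + x.2.1)| * (|a x.2.2| * |b (x.1 + m + x.2.2)|)
      = |b (x.1 + l + x.2.1)| * (|a x.2.1| * |a x.2.2|) * |b (x.1 + m + x.2.2)| := by ring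
    _ ≤ _ := by gcongr; exact abs_le_tsum_abs hb _

/-- If `a` and `b` are summable over `ℤ` and inverse to each other for the convolution, then the
translates of the correlation of `a` and `b` are orthonormal. -/
theorem hasSum_correlation_mul {a b u : ℤ → ℝ} (ha : Summable fun i => |a i|)
    (hb : Summable fun i => |b i|)
    (hab : ∀ n, HasSum (fun i => a i * b (n - i)) (if n = 0 then 1 else 0))
    (hu : ∀ n, HasSum (fun i => a i * b (n + i)) (u n)) (l m : ℤ) :
    HasSum (fun k => u (k + l) * u (k + m)) (if l = m then 1 else 0) := by
  have hF := summable_correlation_triple ha hb l m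
  have hk := hasSum_mul_fiberwise (fun k => hu (k + l)) (fun k => hu (k + m)) hF
    fun k i j => rfl
  -- substitute `k = n - m - i - j`
  let e := shearEquiv fun x : ℤ × ℤ => -m - x.1 - x.2
  have hG := e.summable_iff.mpr hF
  have hn := hasSum_mul_fiberwise hab (fun n => hab (n + (l - m))) hG fun n i j => by
    simp only [e, shearEquiv, Function.comp_apply, Equiv.coe_fn_mk]
    rw [show n + (-m - i - j) + l + i = n + (l - m) - j by ring,
      show n + (-m - i - j) + m + j = n - i by ring]
    ring
  simp only [Function.comp_apply] at hn
  rw [e.tsum_eq (fun x : ℤ × (ℤ × ℤ) =>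
    (a x.2.1 * b (x.1 + l + x.2.1)) * (a x.2.2 * b (x.1 + m + x.2.2)))] at hn
  have h0 := hasSum_single (f := fun n : ℤ => (if n = 0 then (1 : ℝ) else 0) *
    if n + (l - m) = 0 then 1 else 0) 0 fun n hn => by simp [hn]
  rw [hn.unique h0] at hk
  simpa [sub_eq_zero] using hk

lemma summable_abs_correlation {a b u : ℤ → ℝ} (ha : Summable fun i => |a i|)
    (hb : Summable fun i => |b i|) (hu : ∀ n, HasSum (fun i => a i * b (n + i)) (u n)) :
    Summable fun n => |u n| := by
  have h1 : Summable fun x : ℤ × ℤ => |b x.1| * |a x.2| :=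
    hb.mul_of_nonneg ha (fun _ => abs_nonneg _) fun _ => abs_nonneg _
  have h2 : Summable fun x : ℤ × ℤ => |a x.2 * b (x.1 + x.2)| := by
    simpa [Function.comp_def, shearEquiv, abs_mul, mul_comm] using
      (shearEquiv fun i : ℤ => i).summable_iff.mpr h1
  refine .of_nonneg_of_le (fun _ => abs_nonneg _) (fun n => ?_) h2.prod
  rw [← (hu n).tsum_eq]
  have h4 : Summable fun i => |a i * b (n + i)| := h2.prod_factor n
  exact norm_tsum_le_tsum_norm (f := fun i => a i * b (n + i)) h4

/-- A square summable sequence as an element of `ℓ²(ℤ)`. -/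
noncomputable def toL2 {ι : Type*} (g : ι → ℂ) (hg : Summable fun n => ‖g n‖ ^ 2) :
    lp (fun _ : ι => ℂ) 2 :=
  ⟨g, memℓp_gen (by simpa using hg)⟩

/-- A Hankel matrix with orthonormal columns acts isometrically on square summable sequences. -/
theorem hasSum_norm_sq_hankel {u : ℤ → ℝ}
    (hu : ∀ l m, HasSum (fun k => u (k + l) * u (k + m)) (if l = m then 1 else 0))
    {g : ℤ → ℂ} (hg : Summable fun n => ‖g n‖ ^ 2) :
    HasSum (fun k => ‖∑' n, g n * (u (k + n) : ℂ)‖ ^ 2) (∑' n, ‖g n‖ ^ 2) := by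
  have hu2 : ∀ n, Summable fun k => ‖((u (k + n) : ℝ) : ℂ)‖ ^ 2 := fun n => by
    simpa [sq] using (hu n n).summable
  let v : ℤ → lp (fun _ : ℤ => ℂ) 2 := fun n => toL2 (fun k => (u (k + n) : ℂ)) (hu2 n)
  have hv : Orthonormal ℂ v := by
    rw [orthonormal_iff_ite]
    intro l m
    refine (lp.hasSum_inner (v l) (v m)).unique ?_
    have h := Complex.hasSum_ofReal.mpr (hu m l)
    have h' : (((if m = l then 1 else 0 : ℝ)) : ℂ) = if l = m then 1 else 0 := by
      split_ifs with h1 h2 h2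
      exacts [Complex.ofReal_one, absurd h1.symm h2, absurd h2.symm h1, Complex.ofReal_zero]
    have h'' : (fun k => ((u (k + m) * u (k + l) : ℝ) : ℂ)) = fun k => inner ℂ (v l k) (v m k) := by
      funext k
      change _ = (u (k + m) : ℂ) * (starRingEnd ℂ) (u (k + l) : ℂ)
      simp
    rwa [h', h''] at h
  let G := toL2 g hg
  have h1 := hv.orthogonalFamily.hasSum_linearIsometry G
  set S := hv.orthogonalFamily.linearIsometry G with hS
  have hSk : ∀ k, S k = ∑' n, g n * (u (k + n) : ℂ) := fun k => by
    exact ((lp.evalCLM ℂ (fun _ : ℤ => ℂ) 2 k).hasSum h1).tsum_eq.symm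
  have h2 := lp.hasSum_norm (p := 2) (by simp) S
  have h3 := lp.hasSum_norm (p := 2) (by simp) G
  rw [hS, LinearIsometry.norm_map, ← hS] at h2
  rw [← h3.tsum_eq] at h2
  simpa [hSk, G, toL2] using h2

/-! ### The `q`-cosine on the lattice as a correlation -/

/-- `cos(x; q²) = ∑_{n ≥ 0} (-1) ^ n q ^ (n (n - 1)) x ^ (2 n) / [2 n]_q!`. -/
noncomputable def qCos (q x : ℝ) : ℝ :=
  ∑' n : ℕ, (-1) ^ n * q ^ (n * (n - 1)) * x ^ (2 * n) / qFactorial q (2 * n)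

/-- The shifted factorial `(q^{2(j+1)}; q²)_∞`; it vanishes for negative `j`. -/
noncomputable def qTail (q : ℝ) (j : ℤ) : ℝ := qPochInf ((q ^ 2) ^ (j + 1)) (q ^ 2)

/-- The coefficient `(-1)^i q^{i(i-1)} (q^{2(i+1)}; q²)_∞`. -/
noncomputable def eulerCoeff (q : ℝ) (i : ℤ) : ℝ := (-1) ^ i * q ^ (i * (i - 1)) * qTail q i

lemma qTail_sub_one {q : ℝ} (hq0 : 0 < q) (hq1 : q < 1) (j : ℤ) :
    qTail q (j - 1) = (1 - (q ^ 2) ^ j) * qTail q j := by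
  have hp0 : 0 < q ^ 2 := by positivity
  rw [qTail, sub_add_cancel, qPochInf_eq_one_sub_mul hp0 (sq_lt_one_of_pos hq0 hq1), qTail,
    zpow_add_one₀ hp0.ne']

lemma qTail_of_neg {q : ℝ} (hq0 : 0 < q) (hq1 : q < 1) {j : ℤ} (hj : j < 0) : qTail q j = 0 := by
  have h : ∀ k : ℕ, qTail q (-1 - k) = 0 := by
    intro k
    induction k with
    | zero => simpa using qTail_sub_one hq0 hq1 0
    | succ k ih =>
      rw [show (-1 - ((k + 1 : ℕ) : ℤ)) = (-1 - k) - 1 by push_cast; ring,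
        qTail_sub_one hq0 hq1, ih, mul_zero]
  have := h (-1 - j).toNat
  rwa [Int.toNat_of_nonneg (by omega), sub_sub_cancel] at this

lemma qTail_nonneg {q : ℝ} (hq0 : 0 < q) (hq1 : q < 1) (j : ℤ) : 0 ≤ qTail q j := by
  rcases lt_or_ge j 0 with hj | hj
  · rw [qTail_of_neg hq0 hq1 hj]
  · exact qPochInf_nonneg (by positivity) (sq_lt_one_of_pos hq0 hq1)
      (zpow_le_one₀ (by positivity) (sq_lt_one_of_pos hq0 hq1).le (by omega))

lemma qTail_le_one {q : ℝ} (hq0 : 0 < q) (hq1 : q < 1) (j : ℤ) : qTail q j ≤ 1 := by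
  rcases lt_or_ge j 0 with hj | hj
  · rw [qTail_of_neg hq0 hq1 hj]
    exact zero_le_one
  · exact qPochInf_le_one (by positivity) (by positivity)
      (zpow_le_one₀ (by positivity) (sq_lt_one_of_pos hq0 hq1).le (by omega))
      (sq_lt_one_of_pos hq0 hq1)

lemma abs_qTail_le_one {q : ℝ} (hq0 : 0 < q) (hq1 : q < 1) (j : ℤ) : |qTail q j| ≤ 1 := by
  rw [abs_of_nonneg (qTail_nonneg hq0 hq1 j)]
  exact qTail_le_one hq0 hq1 j

lemma qTail_zero_pos {q : ℝ} (hq0 : 0 < q) (hq1 : q < 1) : 0 < qTail q 0 :=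
  qPochInf_pos (by positivity) (sq_lt_one_of_pos hq0 hq1)
    (by simpa using sq_lt_one_of_pos hq0 hq1)

lemma eulerCoeff_of_neg {q : ℝ} (hq0 : 0 < q) (hq1 : q < 1) {i : ℤ} (hi : i < 0) :
    eulerCoeff q i = 0 := by
  rw [eulerCoeff, qTail_of_neg hq0 hq1 hi, mul_zero]

lemma natCast_mul_pred (i : ℕ) : (i : ℤ) * (i - 1) = ((i * (i - 1) : ℕ) : ℤ) := by
  rcases i with _ | i <;> simp

lemma eulerCoeff_natCast {q : ℝ} (hq0 : 0 < q) (hq1 : q < 1) (i : ℕ) :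
    eulerCoeff q i = qTail q 0 * eulerTerm q 1 i := by
  have hp0 : 0 < q ^ 2 := by positivity
  have hp1 := sq_lt_one_of_pos hq0 hq1
  have h := qPochInf_eq_qPoch_mul hp0 hp1 (q ^ 2) i
  have h0 : qTail q 0 = qPoch (q ^ 2) (q ^ 2) i * qTail q i := by
    rw [qTail, qTail, zero_add, zpow_one, h, zpow_add_one₀ hp0.ne', zpow_natCast, mul_comm (_ ^ i)]
  have h1 := (qPoch_pos hp0 hp1 hp1 i).ne'
  rw [eulerCoeff, eulerTerm, h0, natCast_mul_pred, zpow_natCast, zpow_natCast]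
  field_simp
  simp

lemma eulerTerm_mul (q x w : ℝ) (j : ℕ) : eulerTerm q (x * w) j = eulerTerm q x j * w ^ j := by
  simp only [eulerTerm, mul_pow]
  ring

lemma summable_of_natCast {f : ℤ → ℝ} (h : ∀ i < 0, f i = 0) (hf : Summable fun i : ℕ => f i) :
    Summable f := by
  refine (Nat.cast_injective.summable_iff fun i hi => h i ?_).mp hf
  by_contra! h0
  exact hi ⟨i.toNat, Int.toNat_of_nonneg h0⟩

lemma hasSum_of_natCast {f : ℤ → ℝ} {s : ℝ} (h : ∀ i < 0, f i = 0)
    (hf : HasSum (fun i : ℕ => f i) s) : HasSum f s := by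
  refine (Nat.cast_injective.hasSum_iff fun i hi => h i ?_).mp hf
  by_contra! h0
  exact hi ⟨i.toNat, Int.toNat_of_nonneg h0⟩

lemma summable_eulerCoeff_mul_zpow {q : ℝ} (hq0 : 0 < q) (hq1 : q < 1) (x : ℝ) :
    Summable fun i : ℤ => |eulerCoeff q i * x ^ i| := by
  refine summable_of_natCast (fun i hi => by simp [eulerCoeff_of_neg hq0 hq1 hi]) ?_
  refine (((summable_eulerTerm hq0 hq1 x).mul_left (qTail q 0)).abs).congr fun i => ?_
  rw [eulerCoeff_natCast hq0 hq1, zpow_natCast, mul_assoc, ← eulerTerm_mul, one_mul]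

lemma one_sub_mul_eulerCoeff {q : ℝ} (hq0 : 0 < q) (hq1 : q < 1) (i : ℤ) :
    (1 - (q ^ 2) ^ i) * eulerCoeff q i = -((q ^ 2) ^ (i - 1) * eulerCoeff q (i - 1)) := by
  have h1 : q ^ (i * (i - 1)) = q ^ ((i - 1) * (i - 1 - 1)) * (q ^ 2) ^ (i - 1) := by
    rw [← zpow_natCast q 2, ← zpow_mul, ← zpow_add₀ hq0.ne']
    congr 1
    push_cast
    ring
  have h2 : (-1 : ℝ) ^ i = -(-1) ^ (i - 1) := by
    rw [zpow_sub_one₀ (by norm_num)]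
    norm_num
  rw [eulerCoeff, eulerCoeff, qTail_sub_one hq0 hq1, h1, h2]
  ring

/-- The convolution of `eulerCoeff` and `qTail` is a multiple of the unit. -/
lemma hasSum_eulerCoeff_mul_qTail {q : ℝ} (hq0 : 0 < q) (hq1 : q < 1) (n : ℤ) :
    HasSum (fun i => eulerCoeff q i * qTail q (n - i)) (if n = 0 then qTail q 0 ^ 2 else 0) := by
  have hc : Summable fun i : ℤ => |eulerCoeff q i| := by
    simpa using summable_eulerCoeff_mul_zpow hq0 hq1 1
  have hS : Summable fun i => eulerCoeff q i * qTail q (n - i) := by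
    refine .of_norm_bounded hc fun i => ?_
    rw [norm_mul]
    exact mul_le_of_le_one_right (abs_nonneg _) (abs_qTail_le_one hq0 hq1 _)
  split_ifs with hn
  · subst hn
    have := hasSum_single (f := fun i => eulerCoeff q i * qTail q (0 - i)) 0 fun i hi => by
      rcases lt_or_gt_of_ne hi with h | h
      · rw [eulerCoeff_of_neg hq0 hq1 h, zero_mul]
      · rw [qTail_of_neg hq0 hq1 (by omega), mul_zero]
    convert this using 1
    simp [eulerCoeff, sq]
  · have hp0 : 0 < q ^ 2 := by positivity
    let D : ℤ → ℝ := fun i => eulerCoeff q i * (q ^ 2) ^ i * qTail q (n - 1 - i)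
    have hD : Summable D := by
      refine .of_norm_bounded (summable_eulerCoeff_mul_zpow hq0 hq1 (q ^ 2)) fun i => ?_
      rw [norm_mul]
      exact mul_le_of_le_one_right (abs_nonneg _) (abs_qTail_le_one hq0 hq1 _)
    have hD' : Summable fun i => D (i - 1) := (Equiv.subRight (1 : ℤ)).summable_iff.mpr hD
    have hDe : ∑' i, D (i - 1) = ∑' i, D i := (Equiv.subRight (1 : ℤ)).tsum_eq D
    have key : ∀ i, (1 - (q ^ 2) ^ n) * (eulerCoeff q i * qTail q (n - i)) = D i - D (i - 1) := by
      intro i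
      have h1 := one_sub_mul_eulerCoeff hq0 hq1 i
      have h2 := qTail_sub_one hq0 hq1 (n - i)
      have h3 : (q ^ 2) ^ n = (q ^ 2) ^ i * (q ^ 2) ^ (n - i) := by
        rw [← zpow_add₀ hp0.ne', add_sub_cancel]
      simp only [D]
      rw [show n - 1 - i = n - i - 1 by ring, show n - 1 - (i - 1) = n - i by ring, h2, h3]
      linear_combination (qTail q (n - i)) * h1
    have h0 : (1 - (q ^ 2) ^ n) * ∑' i, eulerCoeff q i * qTail q (n - i) = 0 := by
      rw [← tsum_mul_left]
      simp_rw [key]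
      rw [hD.tsum_sub hD', hDe, sub_self]
    have h1 : 1 - (q ^ 2) ^ n ≠ 0 := by
      rw [sub_ne_zero, ne_comm]
      exact fun h => hn ((zpow_eq_one_iff_right₀ hp0.le (sq_lt_one_of_pos hq0 hq1).ne).mp h)
    rw [← (mul_eq_zero.mp h0).resolve_left h1]
    exact hS.hasSum

lemma hasSum_eulerTerm_mul_qPochInf {q : ℝ} (hq0 : 0 < q) (hq1 : q < 1) (y : ℝ) :
    HasSum (fun i : ℕ => eulerTerm q q i * qPochInf (y * (q ^ 2) ^ i) (q ^ 2))
      (qPochInf q (q ^ 2) * ∑' j : ℕ, eulerTerm q y j / qPoch q (q ^ 2) j) := by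
  have hp0 : 0 < q ^ 2 := by positivity
  have hp1 := sq_lt_one_of_pos hq0 hq1
  let F : ℕ × ℕ → ℝ := fun x => eulerTerm q q x.1 * eulerTerm q y x.2 * (q ^ 2) ^ (x.1 * x.2)
  have hF : Summable F := by
    have h : Summable fun x : ℕ × ℕ => |eulerTerm q q x.1| * |eulerTerm q y x.2| :=
      (summable_eulerTerm hq0 hq1 q).abs.mul_of_nonneg (summable_eulerTerm hq0 hq1 y).abs
        (fun _ => abs_nonneg _) fun _ => abs_nonneg _
    refine .of_norm_bounded h fun x => ?_
    rw [Real.norm_eq_abs, abs_mul, abs_mul, abs_of_pos (pow_pos hp0 _)]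
    exact mul_le_of_le_one_right (by positivity) (pow_le_one₀ hp0.le hp1.le)
  have h1 : HasSum (fun i : ℕ => eulerTerm q q i * qPochInf (y * (q ^ 2) ^ i) (q ^ 2))
      (∑' x, F x) := by
    refine HasSum.prod_fiberwise (f := F) hF.hasSum fun i => ?_
    have h3 := (hasSum_eulerTerm hq0 hq1 (y * (q ^ 2) ^ i)).mul_left (eulerTerm q q i)
    have h4 : (fun j => eulerTerm q q i * eulerTerm q (y * (q ^ 2) ^ i) j)
        = fun j => F (i, j) := by
      funext j
      simp only [F, eulerTerm_mul q y, ← pow_mul]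
      ring
    rwa [h4] at h3
  have h2 : HasSum (fun j : ℕ => qPochInf q (q ^ 2) * (eulerTerm q y j / qPoch q (q ^ 2) j))
      (∑' x, F x) := by
    rw [← (Equiv.prodComm ℕ ℕ).tsum_eq F]
    have hF' : Summable fun x : ℕ × ℕ => F (x.2, x.1) := (Equiv.prodComm ℕ ℕ).summable_iff.mpr hF
    refine HasSum.prod_fiberwise (f := fun x : ℕ × ℕ => F (x.2, x.1)) hF'.hasSum fun j => ?_
    have h3 := (hasSum_eulerTerm hq0 hq1 (q * (q ^ 2) ^ j)).mul_left (eulerTerm q y j)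
    have h4 := qPochInf_eq_qPoch_mul hp0 hp1 q j
    have h5 := (qPoch_pos hp0 hp1 hq1 j).ne'
    have h6 : qPochInf q (q ^ 2) * (eulerTerm q y j / qPoch q (q ^ 2) j)
        = eulerTerm q y j * qPochInf (q * (q ^ 2) ^ j) (q ^ 2) := by
      rw [h4]
      field_simp
    have h7 : (fun i => eulerTerm q y j * eulerTerm q (q * (q ^ 2) ^ j) i)
        = fun i => F (i, j) := by
      funext i
      simp only [F, eulerTerm_mul q q, ← pow_mul]
      ring
    rw [h6]
    rwa [h7] at h3
  rw [← tsum_mul_left, h2.tsum_eq]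
  exact h1

lemma qFactorial_two_mul (q : ℝ) (n : ℕ) :
    qFactorial q (2 * n) = qPoch (q ^ 2) (q ^ 2) n * qPoch q (q ^ 2) n / (1 - q) ^ (2 * n) := by
  rw [qFactorial, qPoch_two_mul]

/-- The `q`-cosine at the lattice points as a correlation. -/
lemma hasSum_eulerCoeff_mul_qTail_add {q : ℝ} (hq0 : 0 < q) (hq1 : q < 1) (n : ℤ) :
    HasSum (fun i : ℤ => eulerCoeff q i * q ^ i * qTail q (n + i))
      (qTail q 0 * qPochInf q (q ^ 2) * qCos q (q ^ (n + 1) / (1 - q))) := by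
  have hp0 : 0 < q ^ 2 := by positivity
  have hq : (1 - q) ≠ 0 := by linarith
  refine hasSum_of_natCast (fun i hi => by simp [eulerCoeff_of_neg hq0 hq1 hi]) ?_
  have h := (hasSum_eulerTerm_mul_qPochInf hq0 hq1 ((q ^ 2) ^ (n + 1))).mul_left (qTail q 0)
  have h1 : (fun i : ℕ => eulerCoeff q i * q ^ (i : ℤ) * qTail q (n + i)) = fun i : ℕ =>
      qTail q 0 * (eulerTerm q q i * qPochInf ((q ^ 2) ^ (n + 1) * (q ^ 2) ^ i) (q ^ 2)) := by
    funext i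
    have h2 : eulerTerm q q i = eulerTerm q 1 i * q ^ i := by rw [← eulerTerm_mul, one_mul]
    have h3 : (q ^ 2) ^ (n + i + 1) = (q ^ 2) ^ (n + 1) * (q ^ 2) ^ i := by
      rw [← zpow_natCast (q ^ 2) i, ← zpow_add₀ hp0.ne', add_right_comm]
    rw [eulerCoeff_natCast hq0 hq1, zpow_natCast, h2, qTail, qTail, h3]
    ring
  have h4 : ∑' j : ℕ, eulerTerm q ((q ^ 2) ^ (n + 1)) j / qPoch q (q ^ 2) j
      = qCos q (q ^ (n + 1) / (1 - q)) := by
    refine tsum_congr fun j => ?_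
    have h5 : ((q ^ 2) ^ (n + 1)) ^ j = (q ^ (n + 1)) ^ (2 * j) := by
      rw [pow_mul, ← zpow_natCast q 2, ← zpow_mul, ← zpow_natCast (q ^ (n + 1)) 2, ← zpow_mul,
        mul_comm ((2 : ℕ) : ℤ)]
    have h6 := (qPoch_pos hp0 (sq_lt_one_of_pos hq0 hq1) (sq_lt_one_of_pos hq0 hq1) j).ne'
    have h7 := (qPoch_pos hp0 (sq_lt_one_of_pos hq0 hq1) hq1 j).ne'
    rw [eulerTerm, qFactorial_two_mul, div_pow, h5]
    field_simp
  rw [h1, mul_assoc, ← h4]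
  exact h

/-- The orthonormal sequence built from the values of the `q`-cosine on the lattice,
with `r = q ^ (1 / 2)`. -/
noncomputable def cosKernel (q r : ℝ) (n : ℤ) : ℝ :=
  r ^ n * (qPochInf q (q ^ 2) / qTail q 0 * qCos q (q ^ (n + 1) / (1 - q)))

lemma summable_qTail_mul_zpow {q r : ℝ} (hq0 : 0 < q) (hq1 : q < 1) (hr0 : 0 < r) (hr1 : r < 1) :
    Summable fun j : ℤ => |r ^ j * qTail q j / qTail q 0| := by
  refine summable_of_natCast (fun i hi => by simp [qTail_of_neg hq0 hq1 hi]) ?_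
  refine Summable.of_nonneg_of_le (fun _ => abs_nonneg _) (fun j => ?_)
    ((summable_geometric_of_lt_one hr0.le hr1).div_const (qTail q 0))
  have h0 := qTail_zero_pos hq0 hq1
  rw [abs_div, abs_mul, abs_of_pos h0, zpow_natCast, abs_of_pos (pow_pos hr0 j)]
  gcongr
  exact mul_le_of_le_one_right (by positivity) (abs_qTail_le_one hq0 hq1 _)

lemma summable_eulerCoeff_div {q r : ℝ} (hq0 : 0 < q) (hq1 : q < 1) :
    Summable fun i : ℤ => |eulerCoeff q i * r ^ i / qTail q 0| := by
  simpa only [abs_div] using (summable_eulerCoeff_mul_zpow hq0 hq1 r).div_const |qTail q 0|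

lemma hasSum_cosKernel {q r : ℝ} (hq0 : 0 < q) (hq1 : q < 1) (hr0 : 0 < r) (hr : r ^ 2 = q)
    (n : ℤ) :
    HasSum (fun i => eulerCoeff q i * r ^ i / qTail q 0 * (r ^ (n + i) * qTail q (n + i) / qTail q 0))
      (cosKernel q r n) := by
  have h0 := (qTail_zero_pos hq0 hq1).ne'
  have h := (hasSum_eulerCoeff_mul_qTail_add hq0 hq1 n).mul_left (r ^ n / qTail q 0 ^ 2)
  have h1 : r ^ n / qTail q 0 ^ 2 *
      (qTail q 0 * qPochInf q (q ^ 2) * qCos q (q ^ (n + 1) / (1 - q))) = cosKernel q r n := by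
    rw [cosKernel]
    field_simp
  have h2 : (fun i => eulerCoeff q i * r ^ i / qTail q 0 *
      (r ^ (n + i) * qTail q (n + i) / qTail q 0)) = fun i => r ^ n / qTail q 0 ^ 2 *
        (eulerCoeff q i * q ^ i * qTail q (n + i)) := by
    funext i
    have h3 : q ^ i = r ^ i * r ^ i := by rw [← hr, sq, mul_zpow]
    rw [zpow_add₀ hr0.ne', h3]
    field_simp
  rw [h2, ← h1]
  exact h

lemma lt_one_of_sq {q r : ℝ} (hq1 : q < 1) (hr : r ^ 2 = q) : r < 1 := by nlinarith

lemma summable_abs_cosKernel {q r : ℝ} (hq0 : 0 < q) (hq1 : q < 1) (hr0 : 0 < r) (hr : r ^ 2 = q) :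
    Summable fun n => |cosKernel q r n| :=
  summable_abs_correlation (summable_eulerCoeff_div hq0 hq1)
    (summable_qTail_mul_zpow hq0 hq1 hr0 (lt_one_of_sq hq1 hr)) (hasSum_cosKernel hq0 hq1 hr0 hr)

/-- Orthonormality of the translates of the `q`-cosine kernel. -/
theorem hasSum_cosKernel_mul {q r : ℝ} (hq0 : 0 < q) (hq1 : q < 1) (hr0 : 0 < r) (hr : r ^ 2 = q)
    (l m : ℤ) :
    HasSum (fun k => cosKernel q r (k + l) * cosKernel q r (k + m)) (if l = m then 1 else 0) := by
  refine hasSum_correlation_mul (summable_eulerCoeff_div hq0 hq1)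
    (summable_qTail_mul_zpow hq0 hq1 hr0 (lt_one_of_sq hq1 hr)) (fun n => ?_)
    (hasSum_cosKernel hq0 hq1 hr0 hr) l m
  have h0 := (qTail_zero_pos hq0 hq1).ne'
  have h := (hasSum_eulerCoeff_mul_qTail hq0 hq1 n).mul_left (r ^ n / qTail q 0 ^ 2)
  have h1 : (r ^ n / qTail q 0 ^ 2 * if n = 0 then qTail q 0 ^ 2 else 0)
      = if n = 0 then 1 else 0 := by
    split_ifs with hn
    · subst hn
      field_simp
    · simp
  have h2 : (fun i => eulerCoeff q i * r ^ i / qTail q 0 *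
      (r ^ (n - i) * qTail q (n - i) / qTail q 0)) = fun i => r ^ n / qTail q 0 ^ 2 *
        (eulerCoeff q i * qTail q (n - i)) := by
    funext i
    rw [zpow_sub₀ hr0.ne']
    field_simp
  rw [h2, ← h1]
  exact h

/-! ### The `q`-sine and the `q`-cosine -/

lemma qFactorial_succ (q : ℝ) (n : ℕ) :
    qFactorial q (n + 1) = qFactorial q n * ((1 - q ^ (n + 1)) / (1 - q)) := by
  rw [qFactorial, qFactorial, qPoch_succ, pow_succ, div_mul_div_comm, ← pow_succ']

lemma qFactorial_pos {q : ℝ} (hq0 : 0 < q) (hq1 : q < 1) (n : ℕ) : 0 < qFactorial q n :=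
  div_pos (qPoch_pos hq0 hq1 hq1 n) (pow_pos (by linarith) n)

lemma pow_div_qFactorial_le {q x R : ℝ} (hq0 : 0 < q) (hq1 : q < 1) (hx : |x| ≤ R) (n : ℕ) :
    |x| ^ n / qFactorial q n ≤ (qPochInf q q)⁻¹ * ((1 - q) * R) ^ n := by
  have h1 : 0 < 1 - q := by linarith
  have h0 := qPochInf_pos hq0 hq1 hq1
  have h2 := qPochInf_le_qPoch hq0 hq1 hq0.le hq1 n
  rw [qFactorial, div_div_eq_mul_div, div_eq_inv_mul, mul_pow, mul_comm (|x| ^ n)]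
  gcongr

/-- A summable bound for the terms of `cos(x; q²)` and `sin(x; q²)` on `[-R, R]`. -/
lemma summable_trigBound {q : ℝ} (hq0 : 0 < q) (hq1 : q < 1) (R : ℝ) (c : ℝ) (d : ℕ) :
    Summable fun n : ℕ => q ^ (n * (n - 1)) * (c * ((1 - q) * R) ^ (2 * n + d)) := by
  refine ((summable_pow_mul_pred_mul_pow hq0 hq1 (((1 - q) * R) ^ 2)).mul_right
    (c * ((1 - q) * R) ^ d)).congr fun n => ?_
  generalize (1 - q) * R = y
  rw [abs_of_nonneg (sq_nonneg _), pow_add, pow_mul]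
  ring

lemma abs_trigTerm_le {q x R : ℝ} (hq0 : 0 < q) (hq1 : q < 1) (hx : |x| ≤ R) (n d : ℕ) :
    ‖(-1) ^ n * q ^ (n * (n - 1)) * x ^ (2 * n + d) / qFactorial q (2 * n + d)‖ ≤
      q ^ (n * (n - 1)) * ((qPochInf q q)⁻¹ * ((1 - q) * R) ^ (2 * n + d)) := by
  have h := pow_div_qFactorial_le hq0 hq1 hx (2 * n + d)
  rw [Real.norm_eq_abs, mul_div_assoc, abs_mul, abs_mul, abs_pow, abs_neg, abs_one, one_pow,
    one_mul, abs_div, abs_pow, abs_pow, abs_of_pos hq0, abs_of_pos (qFactorial_pos hq0 hq1 _)]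
  gcongr

lemma summable_trigTerm {q : ℝ} (hq0 : 0 < q) (hq1 : q < 1) (x : ℝ) (d : ℕ) :
    Summable fun n : ℕ =>
      (-1) ^ n * q ^ (n * (n - 1)) * x ^ (2 * n + d) / qFactorial q (2 * n + d) :=
  .of_norm_bounded (summable_trigBound hq0 hq1 |x| _ d) fun n => abs_trigTerm_le hq0 hq1 le_rfl n d

lemma exists_abs_qSin_le {q : ℝ} (hq0 : 0 < q) (hq1 : q < 1) (R : ℝ) :
    ∃ M, ∀ x, |x| ≤ R → |qSin q x| ≤ M :=
  ⟨_, fun _ hx => tsum_of_norm_bounded (summable_trigBound hq0 hq1 R _ 1).hasSum fun n =>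
    abs_trigTerm_le hq0 hq1 hx n 1⟩

lemma exists_abs_qCos_le {q : ℝ} (hq0 : 0 < q) (hq1 : q < 1) (R : ℝ) :
    ∃ M, ∀ x, |x| ≤ R → |qCos q x| ≤ M :=
  ⟨_, fun _ hx => tsum_of_norm_bounded (summable_trigBound hq0 hq1 R _ 0).hasSum fun n =>
    abs_trigTerm_le hq0 hq1 hx n 0⟩

/-- The `q`-difference equation `D_q cos(x; q²) = -q⁻¹ sin(q x; q²)`. -/
lemma qCos_mul_sub_qCos {q : ℝ} (hq0 : 0 < q) (hq1 : q < 1) (x : ℝ) :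
    qCos q (q * x) - qCos q x = (1 - q) * x * q⁻¹ * qSin q (q * x) := by
  have h1 := summable_trigTerm hq0 hq1 (q * x) 0
  have h2 := summable_trigTerm hq0 hq1 x 0
  simp only [add_zero] at h1 h2
  rw [qCos, qCos, ← h1.tsum_sub h2, (h1.sub h2).tsum_eq_zero_add, qSin, ← tsum_mul_left]
  simp only [pow_zero, mul_zero, sub_self, zero_add]
  refine tsum_congr fun n => ?_
  have hF := (qFactorial_pos hq0 hq1 (2 * n + 1)).ne'
  have hq : 1 - q ≠ 0 := by linarith
  have hq2 : 1 - q ^ (2 * n + 1 + 1) ≠ 0 := by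
    have := pow_lt_one₀ hq0.le hq1 (Nat.succ_ne_zero (2 * n + 1))
    exact (sub_pos.mpr this).ne'
  rw [show 2 * (n + 1) = 2 * n + 1 + 1 by ring, qFactorial_succ, ← sub_div,
    div_eq_iff (mul_ne_zero hF (div_ne_zero hq2 hq))]
  rcases n with _ | n
  · simp
    field_simp
    ring
  · simp only [Nat.add_sub_cancel]
    field_simp
    ring

lemma qCos_zpow_sub_qCos {q : ℝ} (hq0 : 0 < q) (hq1 : q < 1) (x : ℝ) (n : ℤ) :
    qCos q (x * q ^ n) - qCos q (x * q ^ (n - 1))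
      = (1 - q) * x * (q ^ 2)⁻¹ * (q ^ n * qSin q (x * q ^ n)) := by
  have h := qCos_mul_sub_qCos hq0 hq1 (x * q ^ (n - 1))
  have h1 : q * (x * q ^ (n - 1)) = x * q ^ n := by
    rw [zpow_sub_one₀ hq0.ne']
    field_simp
  rw [h1] at h
  rw [h, zpow_sub_one₀ hq0.ne']
  field_simp

/-! ### Summation by parts -/

lemma sum_range_int_sub (t : ℤ → ℂ) (N : ℕ) :
    ∑ n ∈ Finset.range N, (t n - t (n + 1)) = t 0 - t N := by
  simpa using Finset.sum_range_sub' (fun n : ℕ => t n) N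

lemma hasSum_nat_sub {t : ℤ → ℂ} (ht : Summable fun n => t n - t (n + 1))
    (htop : Tendsto t atTop (𝓝 0)) : HasSum (fun n : ℕ => t n - t (n + 1)) (t 0) := by
  have hs : Summable fun n : ℕ => t n - t (n + 1) :=
    Summable.comp_injective (f := fun n : ℤ => t n - t (n + 1)) ht Nat.cast_injective
  rw [hs.hasSum_iff_tendsto_nat]
  have h : Tendsto (fun N : ℕ => t 0 - t N) atTop (𝓝 (t 0 - 0)) :=
    tendsto_const_nhds.sub (htop.comp tendsto_natCast_atTop_atTop)
  rw [sub_zero] at h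
  simpa only [sum_range_int_sub] using h

lemma hasSum_int_sub_eq_zero {t : ℤ → ℂ} (ht : Summable fun n => t n - t (n + 1))
    (htop : Tendsto t atTop (𝓝 0)) (hbot : Tendsto t atBot (𝓝 0)) :
    HasSum (fun n => t n - t (n + 1)) 0 := by
  have h1 := hasSum_nat_sub ht htop
  have hs : Summable fun n : ℤ => t (-n) - t (-(n + 1)) := by
    have h := ((Equiv.subLeft (-1 : ℤ)).summable_iff.mpr ht).neg
    refine (summable_congr fun n => ?_).mp h
    simp only [Function.comp_apply, Equiv.subLeft_apply, neg_sub]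
    congr 2 <;> ring
  have h2 := (hasSum_nat_sub (t := fun n => t (-n)) hs (hbot.comp tendsto_neg_atTop_atBot)).neg
  have h3 : HasSum (fun n : ℕ => t (-(n + 1 : ℤ)) - t (-(n + 1 : ℤ) + 1)) (-t 0) := by
    simpa using h2
  simpa using HasSum.of_nat_of_neg_add_one (f := fun n => t n - t (n + 1)) h1 h3

/-! ### The kernel at lattice points -/

/-- The ratio `(q; q²)_∞ / (q²; q²)_∞`. -/
noncomputable def pochRatio (q : ℝ) : ℝ := qPochInf q (q ^ 2) / qTail q 0

lemma pochRatio_pos {q : ℝ} (hq0 : 0 < q) (hq1 : q < 1) : 0 < pochRatio q :=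
  div_pos (qPochInf_pos (by positivity) (sq_lt_one_of_pos hq0 hq1) hq1) (qTail_zero_pos hq0 hq1)

lemma cosKernel_eq {q r : ℝ} (hq0 : 0 < q) {κ : ℤ} (hκ : 1 - q = q ^ κ) (m n : ℤ) :
    cosKernel q r (m + κ - 1 + n) =
      r ^ (m + κ - 1 + n) * (pochRatio q * qCos q (q ^ m * q ^ n)) := by
  rw [cosKernel, pochRatio, hκ, ← zpow_sub₀ hq0.ne', ← zpow_add₀ hq0.ne']
  congr 4
  ring

lemma summable_zpow_mul_qCos {q r : ℝ} (hq0 : 0 < q) (hq1 : q < 1) (hr0 : 0 < r) (hr : r ^ 2 = q)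
    {κ : ℤ} (hκ : 1 - q = q ^ κ) (m : ℤ) :
    Summable fun n : ℤ => |r ^ n * qCos q (q ^ m * q ^ n)| := by
  have hK := pochRatio_pos hq0 hq1
  have h := ((Equiv.addLeft (m + κ - 1)).summable_iff.mpr
    (summable_abs_cosKernel hq0 hq1 hr0 hr)).mul_left |(r ^ (m + κ - 1) * pochRatio q)⁻¹|
  refine h.congr fun n => ?_
  rw [Function.comp_apply, Equiv.coe_addLeft, cosKernel_eq hq0 hκ, ← abs_mul, zpow_add₀ hr0.ne']
  congr 1
  have := (zpow_pos hr0 (m + κ - 1)).ne'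
  field_simp

lemma summable_zpow_natAbs {r : ℝ} (hr0 : 0 < r) (hr1 : r < 1) :
    Summable fun n : ℤ => r ^ n.natAbs := by
  refine Summable.of_nat_of_neg ?_ ?_ <;>
    simpa using summable_geometric_of_lt_one hr0.le hr1

lemma summable_zpow_mul_qSin {q r : ℝ} (hq0 : 0 < q) (hq1 : q < 1) (hr0 : 0 < r) (hr : r ^ 2 = q)
    {κ : ℤ} (hκ : 1 - q = q ^ κ) (m : ℤ) :
    Summable fun n : ℤ => |r ^ n * qSin q (q ^ m * q ^ n)| := by
  have hr1 := lt_one_of_sq hq1 hr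
  have hc := summable_zpow_mul_qCos hq0 hq1 hr0 hr hκ m
  have hc' : Summable fun n : ℤ => |r ^ (n - 1) * qCos q (q ^ m * q ^ (n - 1))| :=
    (Equiv.subRight (1 : ℤ)).summable_iff.mpr hc
  obtain ⟨M, hM⟩ := exists_abs_qSin_le hq0 hq1 (q ^ m)
  have hM0 : 0 ≤ M := (abs_nonneg _).trans (hM 0 (by simpa using (zpow_pos hq0 m).le))
  set A := |((1 - q) * q ^ m * (q ^ 2)⁻¹)⁻¹|
  refine Summable.of_nonneg_of_le (fun _ => abs_nonneg _) (fun n => ?_)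
    (((summable_zpow_natAbs hr0 hr1).mul_right M).add ((hc.add hc').mul_left A))
  have hA : 0 ≤ A := abs_nonneg _
  rcases le_or_gt 0 n with hn | hn
  · lift n to ℕ using hn
    refine le_add_of_le_of_nonneg ?_ (by positivity)
    rw [abs_mul, zpow_natCast, Int.natAbs_natCast, abs_of_pos (pow_pos hr0 n)]
    gcongr
    apply hM
    rw [abs_of_pos (by positivity), zpow_natCast]
    exact mul_le_of_le_one_right (by positivity) (pow_le_one₀ hq0.le hq1.le)
  · refine le_add_of_nonneg_of_le (by positivity) ?_
    have h := qCos_zpow_sub_qCos hq0 hq1 (q ^ m) n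
    have hB : (1 - q) * q ^ m * (q ^ 2)⁻¹ ≠ 0 := by
      have : 1 - q ≠ 0 := by linarith
      positivity
    have hqn : q ^ n = r ^ n * r ^ n := by rw [← hr, sq, mul_zpow]
    have hrn := zpow_pos hr0 n
    have h1 : r ^ n * qSin q (q ^ m * q ^ n) = ((1 - q) * q ^ m * (q ^ 2)⁻¹)⁻¹ *
        ((r ^ n)⁻¹ * (qCos q (q ^ m * q ^ n) - qCos q (q ^ m * q ^ (n - 1)))) := by
      rw [h, hqn, eq_inv_mul_iff_mul_eq₀ hB]
      field_simp
    have h2 : (r ^ n)⁻¹ ≤ r ^ n := by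
      rw [← zpow_neg]
      exact zpow_le_zpow_right_of_le_one₀ hr0 hr1.le (by omega)
    have h3 : (r ^ n)⁻¹ ≤ r ^ (n - 1) := by
      rw [← zpow_neg]
      exact zpow_le_zpow_right_of_le_one₀ hr0 hr1.le (by omega)
    rw [h1, abs_mul]
    gcongr
    rw [abs_mul, abs_mul, abs_mul, abs_of_pos (inv_pos.mpr hrn), abs_of_pos hrn,
      abs_of_pos (zpow_pos hr0 (n - 1))]
    refine (mul_le_mul_of_nonneg_left (abs_sub _ _) (inv_pos.mpr hrn).le).trans ?_
    rw [mul_add]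
    gcongr

lemma exists_norm_le_of_summable_sq {g : ℤ → ℂ} (hg : Summable fun n => ‖g n‖ ^ 2) :
    ∃ B, 0 ≤ B ∧ ∀ n, ‖g n‖ ≤ B :=
  ⟨√(∑' n, ‖g n‖ ^ 2), Real.sqrt_nonneg _, fun n =>
    Real.le_sqrt_of_sq_le (hg.le_tsum n fun _ _ => sq_nonneg _)⟩

lemma summable_norm_mul_of_summable_sq {g : ℤ → ℂ} (hg : Summable fun n => ‖g n‖ ^ 2)
    {v : ℤ → ℝ} (hv : Summable fun n => |v n|) : Summable fun n => ‖g n * (v n : ℂ)‖ := by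
  obtain ⟨B, -, hB⟩ := exists_norm_le_of_summable_sq hg
  refine Summable.of_nonneg_of_le (fun _ => norm_nonneg _) (fun n => ?_) (hv.mul_left B)
  rw [norm_mul, Complex.norm_real, Real.norm_eq_abs]
  exact mul_le_mul_of_nonneg_right (hB n) (abs_nonneg _)

lemma summable_norm_mul_qSin {q r : ℝ} (hq0 : 0 < q) (hq1 : q < 1) (hr0 : 0 < r) (hr : r ^ 2 = q)
    {κ : ℤ} (hκ : 1 - q = q ^ κ) (m : ℤ) {F : ℤ → ℂ}
    (hF : Summable fun n => ‖F n * ((r ^ n : ℝ) : ℂ)‖ ^ 2) :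
    Summable fun n : ℤ => ‖F n * (qSin q (q ^ m * q ^ n) : ℂ) * ((q ^ n : ℝ) : ℂ)‖ := by
  refine (summable_norm_mul_of_summable_sq hF
    (summable_zpow_mul_qSin hq0 hq1 hr0 hr hκ m)).congr fun n => ?_
  have hqn : q ^ n = r ^ n * r ^ n := by rw [← hr, sq, mul_zpow]
  rw [hqn]
  push_cast
  ring_nf

/-- Summation by parts: the sine transform of `F` through the cosine transform of its
differences. -/
lemma tsum_sub_mul_qCos {q r : ℝ} (hq0 : 0 < q) (hq1 : q < 1) (hr0 : 0 < r) (hr : r ^ 2 = q)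
    {κ : ℤ} (hκ : 1 - q = q ^ κ) (m : ℤ) {F : ℤ → ℂ}
    (hF : Summable fun n => ‖F n * ((r ^ n : ℝ) : ℂ)‖ ^ 2)
    (hD : Summable fun n => ‖(F n - F (n + 1)) * (((r ^ n)⁻¹ : ℝ) : ℂ)‖ ^ 2)
    (hF0 : Tendsto F atTop (𝓝 0)) :
    ∑' n, (F n - F (n + 1)) * (qCos q (q ^ m * q ^ n) : ℂ) =
      ((1 - q) * q ^ m * (q ^ 2)⁻¹ : ℝ) *
        ∑' n, F n * (qSin q (q ^ m * q ^ n) : ℂ) * ((q ^ n : ℝ) : ℂ) := by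
  have hr1 := lt_one_of_sq hq1 hr
  have hc := summable_zpow_mul_qCos hq0 hq1 hr0 hr hκ m
  have hS := (summable_norm_mul_qSin hq0 hq1 hr0 hr hκ m hF).of_norm.mul_left
    (((1 - q) * q ^ m * (q ^ 2)⁻¹ : ℝ) : ℂ)
  have hDC : Summable fun n => (F n - F (n + 1)) * (qCos q (q ^ m * q ^ n) : ℂ) := by
    refine ((summable_norm_mul_of_summable_sq hD hc).congr fun n => ?_).of_norm
    have := (zpow_pos hr0 n).ne'
    rw [mul_assoc, ← Complex.ofReal_mul, inv_mul_cancel_left₀ this]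
  let t : ℤ → ℂ := fun n => F n * (qCos q (q ^ m * q ^ (n - 1)) : ℂ)
  have ht : (fun n => t n - t (n + 1)) = fun n =>
      (F n - F (n + 1)) * (qCos q (q ^ m * q ^ n) : ℂ) - (((1 - q) * q ^ m * (q ^ 2)⁻¹ : ℝ) : ℂ) *
        (F n * (qSin q (q ^ m * q ^ n) : ℂ) * ((q ^ n : ℝ) : ℂ)) := by
    funext n
    have h := congrArg (fun y : ℝ => (y : ℂ)) (qCos_zpow_sub_qCos hq0 hq1 (q ^ m) n)
    simp only [Complex.ofReal_sub, Complex.ofReal_mul] at h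
    simp only [t, add_sub_cancel_right, Complex.ofReal_sub, Complex.ofReal_mul]
    linear_combination (-F n) * h
  have htop : Tendsto t atTop (𝓝 0) := by
    obtain ⟨M, hM⟩ := exists_abs_qCos_le hq0 hq1 (q ^ m)
    have h := hF0.norm.mul_const M
    rw [norm_zero, zero_mul] at h
    refine squeeze_zero_norm' ?_ h
    filter_upwards [eventually_ge_atTop 1] with n hn
    rw [norm_mul, Complex.norm_real, Real.norm_eq_abs]
    refine mul_le_mul_of_nonneg_left (hM _ ?_) (norm_nonneg _)
    rw [abs_of_pos (by positivity)]
    exact mul_le_of_le_one_right (by positivity) (zpow_le_one₀ hq0 hq1.le (by omega))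
  have hbot : Tendsto t atBot (𝓝 0) := by
    obtain ⟨B, hB0, hB⟩ := exists_norm_le_of_summable_sq hF
    have hc' : Summable fun n : ℤ => |r ^ (n - 1) * qCos q (q ^ m * q ^ (n - 1))| :=
      (Equiv.subRight (1 : ℤ)).summable_iff.mpr hc
    have h := (hc'.tendsto_cofinite_zero.mono_left atBot_le_cofinite).const_mul B
    rw [mul_zero] at h
    refine squeeze_zero_norm' ?_ h
    filter_upwards [eventually_le_atBot 0] with n hn
    have h1 : 1 ≤ r ^ n := one_le_zpow_of_nonpos₀ hr0 hr1.le hn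
    have h2 : 1 ≤ r ^ (n - 1) := one_le_zpow_of_nonpos₀ hr0 hr1.le (by omega)
    have h3 := hB n
    rw [norm_mul, Complex.norm_real, Real.norm_eq_abs, abs_of_pos (by positivity)] at h3
    rw [norm_mul, Complex.norm_real, Real.norm_eq_abs, abs_mul, abs_of_pos (a := r ^ (n - 1))
      (by positivity)]
    have h4 : ‖F n‖ ≤ B := (le_mul_of_one_le_right (norm_nonneg _) h1).trans h3
    have h5 := le_mul_of_one_le_left (abs_nonneg (qCos q (q ^ m * q ^ (n - 1)))) h2
    exact mul_le_mul h4 h5 (abs_nonneg _) hB0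
  have hs : Summable fun n => t n - t (n + 1) := by
    rw [ht]
    exact hDC.sub hS
  have h0 := hasSum_int_sub_eq_zero hs htop hbot
  rw [ht] at h0
  have := (hDC.hasSum.sub hS.hasSum).unique h0
  rw [tsum_mul_left] at this
  exact sub_eq_zero.mp this

lemma sq_qFourierConst {q : ℝ} (hq0 : 0 < q) (hq1 : q < 1) :
    qFourierConst q ^ 2 = pochRatio q ^ 2 / (q * (1 - q)) := by
  have h1 : (q ^ 2) ^ (1 / 2 : ℝ) = q := by
    rw [← Real.sqrt_eq_rpow, Real.sqrt_sq hq0.le]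
  have h2 : ∀ y : ℝ, 0 ≤ y → (y ^ (1 / 2 : ℝ)) ^ 2 = y := fun y hy => by
    rw [← Real.sqrt_eq_rpow, Real.sq_sqrt hy]
  have hq2 := sq_lt_one_of_pos hq0 hq1
  have h3 : qTail q 0 = qPochInf (q ^ 2) (q ^ 2) := by simp [qTail]
  have h4 := (qTail_zero_pos hq0 hq1).ne'
  have h5 := (qPochInf_pos (p := q ^ 2) (by positivity) hq2 hq1).ne'
  have h6 : 1 - q ≠ 0 := by linarith
  have h7 : 1 - q ^ 2 ≠ 0 := by linarith
  rw [h3] at h4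
  rw [qFourierConst, qGamma, h1, pochRatio, h3, show (1 : ℝ) - 1 / 2 = 1 / 2 by norm_num, div_pow,
    mul_pow, h2 _ (by positivity), h2 _ (by linarith), div_pow, div_pow]
  field_simp
  ring

/-- Plancherel: the weighted `L²` norm of the sine transform of `f` is a multiple of the one of
the differences of `f`. -/
lemma hasSum_norm_sq_qFourierSine {q r : ℝ} (hq0 : 0 < q) (hq1 : q < 1) (hr0 : 0 < r)
    (hr : r ^ 2 = q) {κ : ℤ} (hκ : 1 - q = q ^ κ) {f : ℝ → ℂ}
    (hF : Summable fun n : ℤ => ‖f (q ^ n) * ((r ^ n : ℝ) : ℂ)‖ ^ 2)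
    (hD : Summable fun n : ℤ => ‖(f (q ^ n) - f (q ^ (n + 1))) * (((r ^ n)⁻¹ : ℝ) : ℂ)‖ ^ 2)
    (hF0 : Tendsto (fun n : ℤ => f (q ^ n)) atTop (𝓝 0)) :
    HasSum (fun m : ℤ => (q ^ m) ^ 2 * ‖qFourierSine q f (q ^ m)‖ ^ 2 * q ^ m)
      (q ^ 4 / (1 - q) ^ 2 *
        ∑' n : ℤ, ‖(f (q ^ n) - f (q ^ (n + 1))) * (((r ^ n)⁻¹ : ℝ) : ℂ)‖ ^ 2) := by
  set g : ℤ → ℂ := fun n => (f (q ^ n) - f (q ^ (n + 1))) * (((r ^ n)⁻¹ : ℝ) : ℂ) with hg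
  have hK := pochRatio_pos hq0 hq1
  have hq : 0 < 1 - q := by linarith
  have h := hasSum_norm_sq_hankel (hasSum_cosKernel_mul hq0 hq1 hr0 hr) hD
  have h1 := ((Equiv.addRight (κ - 1)).hasSum_iff.mpr h).mul_left (q ^ 4 / (1 - q) ^ 2)
  have h2 : (fun m : ℤ => (q ^ m) ^ 2 * ‖qFourierSine q f (q ^ m)‖ ^ 2 * q ^ m) = fun m : ℤ =>
      q ^ 4 / (1 - q) ^ 2 *
        ((fun k => ‖∑' n, g n * (cosKernel q r (k + n) : ℂ)‖ ^ 2) ∘ Equiv.addRight (κ - 1)) m := by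
    funext m
    have hZ := tsum_sub_mul_qCos hq0 hq1 hr0 hr hκ m hF hD hF0
    have hu : ∑' n, g n * (cosKernel q r (m + (κ - 1) + n) : ℂ) =
        ((pochRatio q * r ^ (m + κ - 1) : ℝ) : ℂ) *
          ∑' n : ℤ, (f (q ^ n) - f (q ^ (n + 1))) * (qCos q (q ^ m * q ^ n) : ℂ) := by
      rw [← tsum_mul_left]
      refine tsum_congr fun n => ?_
      have hrn : ((r ^ n : ℝ) : ℂ) ≠ 0 := Complex.ofReal_ne_zero.mpr (zpow_pos hr0 n).ne'
      rw [← add_sub_assoc, cosKernel_eq hq0 hκ, zpow_add₀ hr0.ne']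
      simp only [hg, Complex.ofReal_mul, Complex.ofReal_inv]
      field_simp
    have hrm : (r ^ (m + κ - 1)) ^ 2 = q ^ m * (1 - q) / q := by
      rw [hκ, ← zpow_add₀ hq0.ne', div_eq_mul_inv, ← zpow_sub_one₀ hq0.ne', ← hr, ← zpow_natCast, ← zpow_natCast,
        ← zpow_mul, ← zpow_mul, mul_comm]
    simp only [Function.comp_apply, Equiv.coe_addRight]
    rw [hu, hZ, qFourierSine, qIntegral]
    generalize (∑' n : ℤ, f (q ^ n) * (qSin q (q ^ m * q ^ n) : ℂ) * ((q ^ n : ℝ) : ℂ)) = S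
    simp only [norm_mul, Complex.norm_real, Real.norm_eq_abs, mul_pow, sq_abs]
    rw [sq_qFourierConst hq0 hq1, hrm]
    field_simp
  rw [h2]
  exact h1

/-! ### The uncertainty inequality for sequences -/

lemma tsum_mul_le_sqrt_mul_sqrt {a b : ℤ → ℝ} (ha0 : ∀ n, 0 ≤ a n) (hb0 : ∀ n, 0 ≤ b n)
    (ha : Summable fun n => a n ^ 2) (hb : Summable fun n => b n ^ 2) :
    (Summable fun n => a n * b n) ∧
      ∑' n, a n * b n ≤ √(∑' n, a n ^ 2) * √(∑' n, b n ^ 2) := by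
  have h := Real.summable_and_inner_le_Lp_mul_Lq_tsum_of_nonneg
    (p := 2) (q := 2) ⟨by norm_num, by norm_num, by norm_num⟩ ha0 hb0
    (by simpa using ha) (by simpa using hb)
  simpa [Real.sqrt_eq_rpow] using h

lemma tsum_norm_sq_le {q r : ℝ} (hq0 : 0 < q) (hr0 : 0 < r) (hr : r ^ 2 = q)
    {F : ℤ → ℂ} (hF : Summable fun n => ‖F n‖ ^ 2 * q ^ n)
    (hD : Summable fun n => (‖F n - F (n + 1)‖ * (r ^ n)⁻¹) ^ 2)
    (hT : Summable fun n => (q ^ n) ^ 2 * ‖F n‖ ^ 2 * q ^ n) :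
    (1 - q) * ∑' n, ‖F n‖ ^ 2 * q ^ n ≤ q * (1 + (r ^ 3)⁻¹) *
      (√(∑' n, (‖F n - F (n + 1)‖ * (r ^ n)⁻¹) ^ 2) *
        √(∑' n, (q ^ n) ^ 2 * ‖F n‖ ^ 2 * q ^ n)) := by
  set P := ∑' n, ‖F n‖ ^ 2 * q ^ n with hP
  set T := ∑' n, (q ^ n) ^ 2 * ‖F n‖ ^ 2 * q ^ n with hTdef
  have hqr : ∀ n : ℤ, q ^ n = r ^ n * r ^ n := fun n => by rw [← hr, sq, mul_zpow]
  have h0 : ∀ n : ℤ, 0 < r ^ n := fun n => zpow_pos hr0 n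
  -- shifted sums
  have hF' : Summable fun n => ‖F (n + 1)‖ ^ 2 * q ^ n := by
    refine (((Equiv.addRight (1 : ℤ)).summable_iff.mpr hF).mul_left q⁻¹).congr fun n => ?_
    simp only [Function.comp_apply, Equiv.coe_addRight]
    rw [zpow_add_one₀ hq0.ne']
    field_simp
  have hP' : ∑' n, ‖F (n + 1)‖ ^ 2 * q ^ n = q⁻¹ * P := by
    rw [hP, ← (Equiv.addRight (1 : ℤ)).tsum_eq (fun n => ‖F n‖ ^ 2 * q ^ n), ← tsum_mul_left]
    refine tsum_congr fun n => ?_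
    rw [Equiv.coe_addRight, zpow_add_one₀ hq0.ne']
    field_simp
  have e1 : (fun n : ℤ => ((r ^ n) ^ 3 * ‖F n‖) ^ 2)
      = fun n => (q ^ n) ^ 2 * ‖F n‖ ^ 2 * q ^ n := by
    funext n
    rw [hqr]
    ring
  have e2 : (fun n : ℤ => ((r ^ n) ^ 3 * ‖F (n + 1)‖) ^ 2)
      = fun n => (r ^ 6)⁻¹ * ((q ^ (n + 1)) ^ 2 * ‖F (n + 1)‖ ^ 2 * q ^ (n + 1)) := by
    funext n
    rw [hqr, zpow_add_one₀ hr0.ne']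
    field_simp
  have hT1 : Summable fun n : ℤ => ((r ^ n) ^ 3 * ‖F n‖) ^ 2 := by rwa [e1]
  have hT2 : Summable fun n : ℤ => ((r ^ n) ^ 3 * ‖F (n + 1)‖) ^ 2 := by
    rw [e2]
    exact ((Equiv.addRight (1 : ℤ)).summable_iff.mpr hT).mul_left _
  have hT2' : ∑' n : ℤ, ((r ^ n) ^ 3 * ‖F (n + 1)‖) ^ 2 = (r ^ 6)⁻¹ * T := by
    rw [e2, tsum_mul_left, hTdef]
    congr 1
    exact (Equiv.addRight (1 : ℤ)).tsum_eq (fun n => (q ^ n) ^ 2 * ‖F n‖ ^ 2 * q ^ n)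
  have ha0 : ∀ n : ℤ, 0 ≤ ‖F n - F (n + 1)‖ * (r ^ n)⁻¹ := fun n =>
    mul_nonneg (norm_nonneg _) (inv_pos.mpr (h0 n)).le
  have c1 := tsum_mul_le_sqrt_mul_sqrt ha0
    (fun n => mul_nonneg (pow_pos (h0 n) 3).le (norm_nonneg (F n))) hD hT1
  have c2 := tsum_mul_le_sqrt_mul_sqrt ha0
    (fun n => mul_nonneg (pow_pos (h0 n) 3).le (norm_nonneg (F (n + 1)))) hD hT2
  rw [hT2', Real.sqrt_mul (by positivity), show (r ^ 6)⁻¹ = ((r ^ 3)⁻¹) ^ 2 by rw [inv_pow]; ring,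
    Real.sqrt_sq (by positivity)] at c2
  rw [show ∑' n : ℤ, ((r ^ n) ^ 3 * ‖F n‖) ^ 2 = T by rw [e1]] at c1
  have key : q⁻¹ * P - P ≤ ∑' n : ℤ, ‖F n - F (n + 1)‖ * (r ^ n)⁻¹ * ((r ^ n) ^ 3 * ‖F n‖) +
      ∑' n : ℤ, ‖F n - F (n + 1)‖ * (r ^ n)⁻¹ * ((r ^ n) ^ 3 * ‖F (n + 1)‖) := by
    rw [← hP', hP, ← hF'.tsum_sub hF, ← c1.1.tsum_add c2.1]
    refine (hF'.sub hF).tsum_le_tsum (fun n => ?_) (c1.1.add c2.1)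
    have hn := h0 n
    have h1 : ‖F (n + 1)‖ - ‖F n‖ ≤ ‖F n - F (n + 1)‖ := by
      rw [norm_sub_rev]
      exact norm_sub_norm_le _ _
    have h2 : ‖F n - F (n + 1)‖ * (r ^ n)⁻¹ * ((r ^ n) ^ 3 * ‖F n‖) +
        ‖F n - F (n + 1)‖ * (r ^ n)⁻¹ * ((r ^ n) ^ 3 * ‖F (n + 1)‖) =
        q ^ n * (‖F n - F (n + 1)‖ * (‖F n‖ + ‖F (n + 1)‖)) := by
      rw [hqr]
      field_simp
    have h3 : ‖F (n + 1)‖ ^ 2 * q ^ n - ‖F n‖ ^ 2 * q ^ n =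
        q ^ n * ((‖F (n + 1)‖ - ‖F n‖) * (‖F n‖ + ‖F (n + 1)‖)) := by ring
    rw [h2, h3]
    gcongr
  have h4 : (1 - q) * P = q * (q⁻¹ * P - P) := by field_simp
  rw [h4, mul_assoc q]
  refine mul_le_mul_of_nonneg_left ?_ hq0.le
  linarith [c1.2, c2.2]

/-! ### Jackson integrals as sums -/

lemma qLIntegral_ofReal {q : ℝ} {g : ℝ → ℝ} (hg : ∀ t, 0 ≤ g t) :
    qLIntegral q (fun t => ENNReal.ofReal (g t)) =
      ENNReal.ofReal (1 - q) * ∑' n : ℤ, ENNReal.ofReal (g (q ^ n) * q ^ n) := by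
  simp only [qLIntegral, ENNReal.ofReal_mul (hg _)]

lemma summable_of_qLIntegral_ne_top {q : ℝ} (hq0 : 0 < q) (hq1 : q < 1) {g : ℝ → ℝ}
    (hg : ∀ t, 0 ≤ g t) (h : qLIntegral q (fun t => ENNReal.ofReal (g t)) ≠ ⊤) :
    Summable fun n : ℤ => g (q ^ n) * q ^ n := by
  rw [qLIntegral_ofReal hg] at h
  have h1 : ENNReal.ofReal (1 - q) ≠ 0 := by simpa using hq1
  have h2 : ∑' n : ℤ, ENNReal.ofReal (g (q ^ n) * q ^ n) ≠ ⊤ :=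
    fun h3 => h (by rw [h3, ENNReal.mul_top h1])
  refine (ENNReal.summable_toReal h2).congr fun n => ?_
  exact ENNReal.toReal_ofReal (mul_nonneg (hg _) (zpow_pos hq0 n).le)

lemma qLIntegral_eq_ofReal {q s : ℝ} (hq0 : 0 < q) (hq1 : q < 1) {g : ℝ → ℝ}
    (hg : ∀ t, 0 ≤ g t) (h : HasSum (fun n : ℤ => g (q ^ n) * q ^ n) s) :
    qLIntegral q (fun t => ENNReal.ofReal (g t)) = ENNReal.ofReal ((1 - q) * s) := by
  rw [qLIntegral_ofReal hg, ← ENNReal.ofReal_tsum_of_nonneg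
    (fun n => mul_nonneg (hg _) (zpow_pos hq0 n).le) h.summable, h.tsum_eq,
    ENNReal.ofReal_mul (by linarith)]

lemma norm_qDeriv_zpow {q : ℝ} (hq0 : 0 < q) (hq1 : q < 1) (f : ℝ → ℂ) (n : ℤ) :
    ‖qDeriv q f (q ^ n)‖ = ‖f (q ^ n) - f (q ^ (n + 1))‖ / ((1 - q) * q ^ n) := by
  have hn := zpow_pos hq0 n
  rw [qDeriv, if_neg hn.ne', ← zpow_one_add₀ hq0.ne', add_comm, norm_div, Complex.norm_real,
    Real.norm_of_nonneg (mul_nonneg (by linarith) hn.le), add_comm]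

lemma tendsto_zpow_atTop_zero_int {q : ℝ} (hq0 : 0 < q) (hq1 : q < 1) :
    Tendsto (fun n : ℤ => q ^ n) atTop (𝓝 0) := by
  refine ((summable_zpow_natAbs hq0 hq1).tendsto_cofinite_zero.mono_left
    atTop_le_cofinite).congr' ?_
  filter_upwards [eventually_ge_atTop 0] with n hn
  rw [← zpow_natCast, Int.natAbs_of_nonneg hn]

lemma tendsto_zpow_nhdsWithin_qLattice {q : ℝ} (hq0 : 0 < q) (hq1 : q < 1) :
    Tendsto (fun n : ℤ => q ^ n) atTop (𝓝[qLattice q] 0) :=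
  tendsto_nhdsWithin_iff.mpr
    ⟨tendsto_zpow_atTop_zero_int hq0 hq1, Eventually.of_forall fun n => ⟨n, rfl⟩⟩

lemma eq_zero_of_sub_eq_zero {F : ℤ → ℂ} (h : ∀ n, F n - F (n + 1) = 0)
    (h0 : Tendsto F atTop (𝓝 0)) (n : ℤ) : F n = 0 := by
  have h1 : ∀ k : ℕ, F (n + k) = F n := by
    intro k
    induction k with
    | zero => simp
    | succ k ih => rw [← ih, Nat.cast_succ, ← add_assoc, eq_comm]; exact sub_eq_zero.mp (h _)
  have h2 : Tendsto (fun k : ℕ => F (n + k)) atTop (𝓝 0) :=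
    h0.comp (tendsto_atTop_add_const_left _ n tendsto_natCast_atTop_atTop)
  simp only [h1] at h2
  exact tendsto_nhds_unique tendsto_const_nhds h2

theorem mainTheorem2 (q : ℝ) (hq0 : 0 < q) (hq1 : q < 1)
    (hq : ∃ k : ℤ, Real.log (1 - q) / Real.log q = (k : ℝ))
    (f : ℝ → ℂ) (hf : MemL2q q f) (hDf : MemL2q q (qDeriv q f))
    (hf0 : Tendsto f (𝓝[qLattice q] 0) (𝓝 0)) :
    (∀ x ∈ qLattice q, QIntegrable q fun t => f t * (qSin q (x * t) : ℂ)) ∧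
    qLIntegral q (fun t => ENNReal.ofReal (t ^ 2 * ‖f t‖ ^ 2)) ^ (1 / 2 : ℝ) *
        qLIntegral q (fun x => ENNReal.ofReal (x ^ 2 * ‖qFourierSine q f x‖ ^ 2)) ^ (1 / 2 : ℝ) ≥
      ENNReal.ofReal (q / (q ^ (-3 / 2 : ℝ) + 1)) * l2qNorm q f ^ 2 := by
  have h1q : 0 < 1 - q := by linarith
  obtain ⟨κ, hκ⟩ : ∃ κ : ℤ, 1 - q = q ^ κ := by
    obtain ⟨k, hk⟩ := hq
    refine ⟨k, ?_⟩
    rw [div_eq_iff (Real.log_neg hq0 hq1).ne, ← Real.log_zpow] at hk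
    exact Real.log_injOn_pos h1q (zpow_pos hq0 k) hk
  obtain ⟨r, hr0, hr⟩ : ∃ r, 0 < r ∧ r ^ 2 = q :=
    ⟨√q, Real.sqrt_pos.mpr hq0, Real.sq_sqrt hq0.le⟩
  have hqr : ∀ n : ℤ, q ^ n = r ^ n * r ^ n := fun n => by rw [← hr, sq, mul_zpow]
  have hrn : ∀ n : ℤ, 0 < r ^ n := fun n => zpow_pos hr0 n
  -- the sequences attached to `f` and to its `q`-derivative
  have hF : Summable fun n : ℤ => ‖f (q ^ n)‖ ^ 2 * q ^ n :=
    summable_of_qLIntegral_ne_top (g := fun t => ‖f t‖ ^ 2) hq0 hq1 (fun t => sq_nonneg _) hf.ne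
  have hF' : Summable fun n : ℤ => ‖f (q ^ n) * ((r ^ n : ℝ) : ℂ)‖ ^ 2 := by
    refine (summable_congr fun n => ?_).mp hF
    rw [norm_mul, Complex.norm_real, Real.norm_of_nonneg (hrn n).le, hqr]
    ring
  have hD : Summable fun n : ℤ => (‖f (q ^ n) - f (q ^ (n + 1))‖ * (r ^ n)⁻¹) ^ 2 := by
    have h : Summable fun n : ℤ => ‖qDeriv q f (q ^ n)‖ ^ 2 * q ^ n :=
      summable_of_qLIntegral_ne_top (g := fun t => ‖qDeriv q f t‖ ^ 2) hq0 hq1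
        (fun t => sq_nonneg _) hDf.ne
    refine (summable_congr fun n => ?_).mp (h.mul_left ((1 - q) ^ 2))
    have := hrn n
    rw [norm_qDeriv_zpow hq0 hq1, hqr]
    field_simp
  have hDe : (fun n : ℤ => ‖(f (q ^ n) - f (q ^ (n + 1))) * (((r ^ n)⁻¹ : ℝ) : ℂ)‖ ^ 2) =
      fun n : ℤ => (‖f (q ^ n) - f (q ^ (n + 1))‖ * (r ^ n)⁻¹) ^ 2 := by
    funext n
    rw [norm_mul, Complex.norm_real, Real.norm_of_nonneg (inv_pos.mpr (hrn n)).le]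
  have hF0 : Tendsto (fun n : ℤ => f (q ^ n)) atTop (𝓝 0) :=
    hf0.comp (tendsto_zpow_nhdsWithin_qLattice hq0 hq1)
  refine ⟨?_, ?_⟩
  · rintro _ ⟨m, rfl⟩
    exact summable_norm_mul_qSin hq0 hq1 hr0 hr hκ m hF'
  have hW := hasSum_norm_sq_qFourierSine hq0 hq1 hr0 hr hκ hF' (by rwa [hDe]) hF0
  rw [hDe] at hW
  set E := ∑' n : ℤ, (‖f (q ^ n) - f (q ^ (n + 1))‖ * (r ^ n)⁻¹) ^ 2 with hE
  have hE0 : 0 ≤ E := tsum_nonneg fun n => sq_nonneg _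
  rw [qLIntegral_eq_ofReal (g := fun x => x ^ 2 * ‖qFourierSine q f x‖ ^ 2) hq0 hq1
    (fun t => by positivity) hW]
  by_cases hT : qLIntegral q (fun t => ENNReal.ofReal (t ^ 2 * ‖f t‖ ^ 2)) = ⊤
  · have hEpos : 0 < E := by
      refine hE0.lt_of_ne' fun hE' => ?_
      have h1 := (hasSum_zero_iff_of_nonneg fun n => sq_nonneg _).mp (hE' ▸ hE ▸ hD.hasSum)
      have h2 : ∀ n : ℤ, f (q ^ n) - f (q ^ (n + 1)) = 0 := fun n => by
        simpa [(hrn n).ne'] using congrFun h1 n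
      have h3 := eq_zero_of_sub_eq_zero (F := fun n : ℤ => f (q ^ n)) h2 hF0
      rw [qLIntegral_ofReal fun t => by positivity] at hT
      simp [h3] at hT
    have h : ENNReal.ofReal ((1 - q) * (q ^ 4 / (1 - q) ^ 2 * E)) ^ (1 / 2 : ℝ) ≠ 0 := by
      have : 0 < (1 - q) * (q ^ 4 / (1 - q) ^ 2 * E) := by positivity
      exact (ENNReal.rpow_pos (ENNReal.ofReal_pos.mpr this) ENNReal.ofReal_ne_top).ne'
    rw [hT, ENNReal.top_rpow_of_pos (by norm_num), ENNReal.top_mul h]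
    exact le_top
  · have hT' : Summable fun n : ℤ => (q ^ n) ^ 2 * ‖f (q ^ n)‖ ^ 2 * q ^ n :=
      summable_of_qLIntegral_ne_top (g := fun t => t ^ 2 * ‖f t‖ ^ 2) hq0 hq1
        (fun t => by positivity) hT
    have hmain := tsum_norm_sq_le (F := fun n : ℤ => f (q ^ n)) hq0 hr0 hr hF hD hT'
    rw [l2qNorm, qLIntegral_eq_ofReal (g := fun t => ‖f t‖ ^ 2) hq0 hq1 (fun t => sq_nonneg _)
        hF.hasSum,
      qLIntegral_eq_ofReal (g := fun t => t ^ 2 * ‖f t‖ ^ 2) hq0 hq1 (fun t => by positivity)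
        hT'.hasSum]
    rw [← hE] at hmain
    set P := ∑' n : ℤ, ‖f (q ^ n)‖ ^ 2 * q ^ n
    set T := ∑' n : ℤ, (q ^ n) ^ 2 * ‖f (q ^ n)‖ ^ 2 * q ^ n
    have hT0 : 0 ≤ T := tsum_nonneg fun n => by positivity
    have hP0 : 0 ≤ P := tsum_nonneg fun n => by positivity
    have hr3 : q ^ (-3 / 2 : ℝ) = (r ^ 3)⁻¹ := by
      rw [← hr, ← Real.rpow_natCast r 2, ← Real.rpow_mul hr0.le, ← Real.rpow_natCast r 3,
        ← Real.rpow_neg hr0.le]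
      norm_num
    have hs : ∀ x : ℝ, 0 ≤ x → ENNReal.ofReal x ^ (1 / 2 : ℝ) = ENNReal.ofReal √x := fun x hx => by
      rw [ENNReal.ofReal_rpow_of_nonneg hx (by norm_num), Real.sqrt_eq_rpow]
    rw [ge_iff_le, hs _ (by positivity), hs _ (by positivity), hs _ (by positivity),
      ← ENNReal.ofReal_pow (Real.sqrt_nonneg _), Real.sq_sqrt (by positivity), hr3,
      ← ENNReal.ofReal_mul (by positivity), ← ENNReal.ofReal_mul (by positivity)]
    refine ENNReal.ofReal_le_ofReal ?_
    rw [← Real.sqrt_mul (by positivity)]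
    have h1 : (1 - q) * T * ((1 - q) * (q ^ 4 / (1 - q) ^ 2 * E)) = (q ^ 2) ^ 2 * (E * T) := by
      field_simp
    rw [h1, Real.sqrt_mul (by positivity), Real.sqrt_sq (by positivity), Real.sqrt_mul hE0,
      div_mul_eq_mul_div, div_le_iff₀ (by positivity)]
    calc q * ((1 - q) * P) ≤ q * (q * (1 + (r ^ 3)⁻¹) * (√E * √T)) :=
          mul_le_mul_of_nonneg_left hmain hq0.le
      _ = q ^ 2 * (√E * √T) * ((r ^ 3)⁻¹ + 1) := by ring
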